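/- Let $N,M\ge 1$ and let $\mathcal S$ be the set of the $K=NM$ encryption methods (a technique, out of $N$, with one of its $M$ keys). Consider the two-player stochastic game with state space $\mathcal S$ in which, at every time $t=1,2,\dots$, in the current state $s_t$, the defender chooses a method $a^1\in\mathcal A_1=\mathcal S$ and the attacker simultaneously chooses a technique $a^2\in\mathcal A_2=\{1,\dots,N\}$; then $s_{t+1}=a^1$ with probability one. Let $n_t$ be the number of consecutive method changes in the past time steps: $n_1=0$, $n_{t+1}=n_t+1$ if $s_{t+1}\ne s_t$, and $n_{t+1}=0$ if $s_{t+1}=s_t$. For arbitrary real functions $R_1,T_1,P_1,R_2,P_2$ and $q\in\mathbb R$, the utilities at time $t$ are $$U_1=R_1(a^2)+T_1(a^1,a^2,s_t)-P_1(s_t)-C(q,n_t),\qquad C(q,n)=q\ln(n+1),$$ $$U_2=R_2(a^1,a^2,s_t)-P_2(s_t),$$ and, for a discount factor $0<\beta<1$ and an initial state $s_1=s$, the accumulated utility $\Phi_i$ of player $i$ is $\sum_{t\ge1}\beta^{t-1}$ times the (expected) utility of player $i$ at time $t$. A pure stationary strategy is a map $f:\mathcal S\to\mathcal A_1$, respectively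 $g:\mathcal S\to\mathcal A_2$; a behaviour strategy assigns to each finite history (initial state and past action pairs) a probability distribution on the player's actions. Then: 1. The accumulated utility of the defender is bounded: there is $B$ such that for every pair of pure stationary strategies and for every pair of behaviour strategies, and every initial state, the series defining $\Phi_1$ converges absolutely and $|\Phi_1|\le B$. 2. The bimatrix game $(X,Y)$ whose rows and columns are the pure stationary strategies $f$ and $g$, with $X_{f,g}=\sum_{s\in\mathcal S}\Phi_1(f,g,s)$ for the defender and $Y_{f,g}=\sum_{s\in\mathcal S}U_2(f(s),g(s),s)$ (the attacker's utility at the first time step) for the attacker, has a mixed strategy Nash equilibrium. 3. The stochastic game has a Nash equilibrium $(E^*,H^*)$ in mixed strategies that are stationary with respect to the current state and the current number of consecutive changes $(s_t,n_t)$: for every initial state $s$, $\Phi_1(\hat E,H^*,s)\le\Phi_1(E^*,H^*,s)$ and $\Phi_2(E^*,\hat H,s)\le\Phi_2(E^*,H^*,s)$ for all behaviour strategies $\hat E$ of the defender and $\hat H$ of the attacker. -/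

import Mathlib

/-- An encryption method: one of `N` techniques together with one of its `M` keys. The methods are
the `K = N * M` states of the game, and also the actions of the defender. -/
abbrev Method (N M : ℕ) : Type := Fin N × Fin M

/-- The data of the moving target defense game with `N` techniques and `M` keys per technique.
The defender's action is the next method (the game moves to it with probability one), the
attacker's action is the technique it tries to decrypt. The arguments of `T₁` and `R₂` are the
defender's action, the attacker's action and the current state. -/
structure MTDGame (N M : ℕ) where
  R₁ : Fin N → ℝ
  T₁ : Method N M → Fin N → Method N M → ℝ
  P₁ : Method N M → ℝ
  R₂ : Method N M → Fin N → Method N M → ℝ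
  P₂ : Method N M → ℝ
  β : ℝ
  β_pos : 0 < β
  β_lt_one : β < 1

/-- The logarithmic cost `C(q, n) = q * ln (n + 1)`. -/
noncomputable def logCost (q : ℝ) (n : ℕ) : ℝ := q * Real.log ((n : ℝ) + 1)

namespace MTDGame

variable {N M : ℕ}

/-- Utility of the defender in state `s` after `n` consecutive method changes, with cost
function `C`. -/
def U₁ (G : MTDGame N M) (C : ℕ → ℝ) (a : Method N M) (b : Fin N) (s : Method N M) (n : ℕ) : ℝ :=
  G.R₁ b + G.T₁ a b s - G.P₁ s - C n

/-- Utility of the attacker. -/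
def U₂ (G : MTDGame N M) (a : Method N M) (b : Fin N) (s : Method N M) : ℝ :=
  G.R₂ a b s - G.P₂ s

end MTDGame

section Pure

variable {N M : ℕ}

/-- The states visited from `s` under the pure stationary defender strategy `f`; time starts
at `0`. -/
def statePath (f : Method N M → Method N M) (s : Method N M) : ℕ → Method N M
  | 0 => s
  | t + 1 => f (statePath f s t)

/-- The number of consecutive method changes immediately before time `t` along a sequence of
methods. -/
def changeCount (p : ℕ → Method N M) : ℕ → ℕ
  | 0 => 0
  | t + 1 => if p (t + 1) = p t then 0 else changeCount p t + 1

namespace MTDGame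

/-- The discounted utility of the defender at time `t` when the pure stationary strategies `f`, `g`
are played from `s`. -/
def pureTerm₁ (G : MTDGame N M) (C : ℕ → ℝ) (f : Method N M → Method N M) (g : Method N M → Fin N)
    (s : Method N M) (t : ℕ) : ℝ :=
  G.β ^ t * G.U₁ C (f (statePath f s t)) (g (statePath f s t)) (statePath f s t)
    (changeCount (statePath f s) t)

/-- The accumulated utility of the defender for pure stationary strategies. -/
noncomputable def pureΦ₁ (G : MTDGame N M) (C : ℕ → ℝ) (f : Method N M → Method N M)
    (g : Method N M → Fin N) (s : Method N M) : ℝ :=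
  ∑' t, G.pureTerm₁ C f g s t

/-- The defender's matrix: rows and columns are the pure stationary strategies of the defender and
of the attacker, entries are accumulated utilities summed over all initial states. -/
noncomputable def X (G : MTDGame N M) (C : ℕ → ℝ) :
    Matrix (Method N M → Method N M) (Method N M → Fin N) ℝ :=
  fun f g => ∑ s, G.pureΦ₁ C f g s

/-- The attacker's matrix; the attacker's utility is only evaluated at the first time step. -/
def Y (G : MTDGame N M) : Matrix (Method N M → Method N M) (Method N M → Fin N) ℝ :=
  fun f g => ∑ s, G.U₂ (f s) (g s) s

end MTDGame

end Pure

/-- `(x, y)` is a mixed strategy Nash equilibrium of the bimatrix game `(A, B)`; the row player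
receives `A` and the column player receives `B`. -/
def IsBimatrixEquilibrium {ι κ : Type*} [Fintype ι] [Fintype κ] (A B : Matrix ι κ ℝ)
    (x : stdSimplex ℝ ι) (y : stdSimplex ℝ κ) : Prop :=
  (∀ x' : stdSimplex ℝ ι, ∑ i, ∑ j, x'.1 i * y.1 j * A i j ≤ ∑ i, ∑ j, x.1 i * y.1 j * A i j) ∧
  (∀ y' : stdSimplex ℝ κ, ∑ i, ∑ j, x.1 i * y'.1 j * B i j ≤ ∑ i, ∑ j, x.1 i * y.1 j * B i j)

/-- A finite history of the game: the initial state followed by the action pairs played so far. -/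
inductive History (N M : ℕ) : Type
  | start (s : Method N M) : History N M
  | next (h : History N M) (a : Method N M) (b : Fin N) : History N M

namespace History

variable {N M : ℕ}

/-- The current state: the initial one, or the one chosen by the defender's last action. -/
def state : History N M → Method N M
  | start s => s
  | next _ a _ => a

/-- The number of consecutive method changes in the past time steps. -/
def changes : History N M → ℕ
  | start _ => 0
  | next h a _ => if a = h.state then 0 else h.changes + 1

end History

/-- Behaviour strategies of the defender: a mixed action after each history. -/
abbrev DefStrategy (N M : ℕ) : Type := History N M → stdSimplex ℝ (Method N M)

/-- Behaviour strategies of the attacker. -/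
abbrev AttStrategy (N M : ℕ) : Type := History N M → stdSimplex ℝ (Fin N)

/-- The strategy that plays at each time a mixed action depending only on the current state and
on the current number of consecutive changes. -/
def stationary {N M : ℕ} {D : Type*} (e : Method N M → ℕ → D) : History N M → D :=
  fun h => e h.state h.changes

/-- `expectedStage σ τ u t h` is the expected value of the stage utility `u` received `t` steps
after the history `h`, when `σ` and `τ` are played from `h` on; the two players randomize
independently. -/
def expectedStage {N M : ℕ} (σ : DefStrategy N M) (τ : AttStrategy N M)
    (u : Method N M → Fin N → History N M → ℝ) : ℕ → History N M → ℝ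
  | 0, h => ∑ a, ∑ b, (σ h).1 a * (τ h).1 b * u a b h
  | t + 1, h => ∑ a, ∑ b, (σ h).1 a * (τ h).1 b * expectedStage σ τ u t (h.next a b)

namespace MTDGame

variable {N M : ℕ}

/-- The discounted expected utility of the defender at time `t`, from the initial state `s`. -/
def term₁ (G : MTDGame N M) (C : ℕ → ℝ) (σ : DefStrategy N M) (τ : AttStrategy N M)
    (s : Method N M) (t : ℕ) : ℝ :=
  G.β ^ t * expectedStage σ τ (fun a b h => G.U₁ C a b h.state h.changes) t (.start s)

/-- The discounted expected utility of the attacker at time `t`, from the initial state `s`. -/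
def term₂ (G : MTDGame N M) (σ : DefStrategy N M) (τ : AttStrategy N M)
    (s : Method N M) (t : ℕ) : ℝ :=
  G.β ^ t * expectedStage σ τ (fun a b h => G.U₂ a b h.state) t (.start s)

/-- The accumulated expected utility of the defender. -/
noncomputable def Φ₁ (G : MTDGame N M) (C : ℕ → ℝ) (σ : DefStrategy N M) (τ : AttStrategy N M)
    (s : Method N M) : ℝ :=
  ∑' t, G.term₁ C σ τ s t

/-- The accumulated expected utility of the attacker. The stage utilities of the attacker are
bounded, so this series always converges. -/
noncomputable def Φ₂ (G : MTDGame N M) (σ : DefStrategy N M) (τ : AttStrategy N M)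
    (s : Method N M) : ℝ :=
  ∑' t, G.term₂ σ τ s t

/-- Nash equilibrium of the stochastic game: from no initial state can a player gain by deviating
unilaterally, to any history-dependent randomized strategy. -/
def IsNashEquilibrium (G : MTDGame N M) (C : ℕ → ℝ) (σ : DefStrategy N M) (τ : AttStrategy N M) :
    Prop :=
  ∀ s : Method N M,
    (∀ σ' : DefStrategy N M, G.Φ₁ C σ' τ s ≤ G.Φ₁ C σ τ s) ∧
    (∀ τ' : AttStrategy N M, G.Φ₂ σ τ' s ≤ G.Φ₂ σ τ s)

end MTDGame

/-! Boundedness: the counter grows by at most one per step and `ln (n + 1) ≤ n`, so stage utilities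
grow at most linearly in time and the discounted series has a summable majorant
(`abs_tsum_discounted_le`). The bimatrix claim is Nash's theorem and uses nothing about the two
matrices.

For the stochastic game, every pair (state, counter) becomes a separate agent of each player. A
defender agent values an action by playing it once and then following the profile (`actionValue₁`);
an attacker agent looks only at the current expected utility. These payoffs are continuous in the
product topology, so Nash's theorem for infinitely many agents (`exists_equilibrium_pi`) yields a
profile that no single action improves. For the defender, the one-shot deviation principle
(`Φ₁_le_of_actionValue₁_le`) extends this to all behaviour strategies; unbounded costs do no harm
because the truncation error is `β ^ T` times an affine function of `T`. For the attacker, stagewise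
optimality suffices because the transitions ignore its actions (`Φ₂_le_of_stage_le`).

Nash's theorem comes from a fixed point of Nash's improvement map. Brouwer's theorem on a simplex is
derived from Scarf's combinatorial lemma, a parity argument; a retraction carries it to finite
products of simplices and compactness to arbitrary ones. -/

/-! ### Scarf's combinatorial lemma. -/

section Scarf

variable {I Y : Type*}

/-- A finite set `ρ` is dominant for the orders given by the ranks `r i` if no point lies strictly
above the `r i`-minimum of `ρ` for all `i` simultaneously. -/
def Dominant (r : I → Y → ℕ) (ρ : Finset Y) : Prop :=
  ∀ y, ∃ i, ∀ s ∈ ρ, r i y ≤ r i s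

theorem Dominant.mono {r : I → Y → ℕ} {δ ρ : Finset Y} (h : Dominant r ρ) (hs : δ ⊆ ρ) :
    Dominant r δ := fun y => (h y).imp fun _ hi s hsδ => hi s (hs hsδ)

open Finset in
-- The pivot step: order `i` gives up its minimum, which stays in use as the minimum of order `j`.
-- The new point must be the `r i`-largest among the points above the minima of all other orders: a
-- larger one would violate dominance.
theorem existsUnique_insert_dominant [Fintype Y] [DecidableEq Y]
    {r : I → Y → ℕ} (hinj : ∀ i, Function.Injective (r i)) {δ : Finset Y} (hδ : Dominant r δ)
    {m : I → Y} (hmem : ∀ i, m i ∈ δ) (hmle : ∀ i, ∀ s ∈ δ, r i (m i) ≤ r i s)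
    (hsurj : ∀ s ∈ δ, ∃ i, m i = s) {i j : I} (hij : i ≠ j) (hm : m i = m j)
    (hne : ∃ z, ∀ l, l ≠ i → r l (m l) < r l z) :
    ∃! y, y ∉ δ ∧ Dominant r (insert y δ) ∧ ∀ l, l ≠ i → r l (m l) < r l y := by
  classical
  obtain ⟨z, hz⟩ := hne
  obtain ⟨y, hy, hmax⟩ := exists_max_image
    (univ.filter fun z => ∀ l, l ≠ i → r l (m l) < r l z) (r i) ⟨z, by simpa using hz⟩
  simp only [mem_filter, mem_univ, true_and] at hy hmax
  have hdom : Dominant r (insert y δ) := by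
    intro x
    by_cases hx : ∀ l, l ≠ i → r l (m l) < r l x
    · obtain ⟨l, hl⟩ := hδ x
      refine ⟨i, fun t ht => ?_⟩
      rcases mem_insert.1 ht with rfl | ht
      · exact hmax x hx
      · by_cases h : l = i
        · exact h ▸ hl t ht
        · exact absurd (hl _ (hmem l)) (not_le.2 (hx l h))
    · push Not at hx
      obtain ⟨l, hli, hl⟩ := hx
      refine ⟨l, fun t ht => ?_⟩
      rcases mem_insert.1 ht with rfl | ht
      · exact hl.trans (hy l hli).le
      · exact hl.trans (hmle l t ht)
  have key : ∀ u v, Dominant r (insert u δ) → (∀ l, l ≠ i → r l (m l) < r l v) →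
      r i v ≤ r i u := by
    intro u v hu hv
    obtain ⟨l, hl⟩ := hu v
    by_cases h : l = i
    · exact h ▸ hl u (mem_insert_self _ _)
    · exact absurd (hl _ (mem_insert_of_mem (hmem l))) (not_le.2 (hv l h))
  refine ⟨y, ⟨?_, hdom, hy⟩, ?_⟩
  · intro hyδ
    obtain ⟨l, hl⟩ := hsurj y hyδ
    by_cases h : l = i
    · have := hy j hij.symm
      rw [← hm, ← h, hl] at this
      exact lt_irrefl _ this
    · have := hy l h
      rw [hl] at this
      exact lt_irrefl _ this
  · rintro x ⟨-, hx, hxi⟩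
    exact hinj i (le_antisymm (key y x hdom hxi) (key x y hx hy))

open Finset in
/-- A dominant set with one element less than there are orders is contained in exactly two dominant
sets with as many elements as there are orders, if it contains a point that lies below `p l` in all
orders except the `l`-th. -/
theorem card_dominant_superset_eq_two [Fintype I] [Fintype Y] [DecidableEq Y]
    {r : I → Y → ℕ} (hinj : ∀ i, Function.Injective (r i)) {δ : Finset Y} (hδ : Dominant r δ)
    (hcard : #δ + 1 = Fintype.card I) {w : Y} (hw : w ∈ δ) {p : I → Y}
    (hp : ∀ i l, i ≠ l → r i w < r i (p l)) (S : Finset (Finset Y))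
    (hS : ∀ ρ, ρ ∈ S ↔ (Dominant r ρ ∧ #ρ = Fintype.card I) ∧ δ ⊆ ρ) : #S = 2 := by
  classical
  have hmin : ∀ i, ∃ x ∈ δ, ∀ s ∈ δ, r i x ≤ r i s := fun i => exists_min_image δ (r i) ⟨w, hw⟩
  choose m hmem hmle using hmin
  have hsurj : ∀ s ∈ δ, ∃ i, m i = s := by
    intro s hs
    obtain ⟨i, hi⟩ := hδ s
    exact ⟨i, hinj i (le_antisymm (hmle i s hs) (hi _ (hmem i)))⟩
  obtain ⟨i, -, j, -, hij, hm⟩ := exists_ne_map_eq_of_card_lt_of_maps_to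
    (s := (univ : Finset I)) (t := δ) (by rw [card_univ]; omega) (fun i _ => hmem i)
  have hne : ∀ i, ∃ z, ∀ l, l ≠ i → r l (m l) < r l z := fun i =>
    ⟨p i, fun l hl => (hmle l w hw).trans_lt (hp l i hl)⟩
  obtain ⟨y, ⟨hyδ, hyd, hyi⟩, hyu⟩ :=
    existsUnique_insert_dominant hinj hδ hmem hmle hsurj hij hm (hne i)
  obtain ⟨z, ⟨hzδ, hzd, hzi⟩, hzu⟩ :=
    existsUnique_insert_dominant hinj hδ hmem hmle hsurj hij.symm hm.symm (hne j)
  -- A common point would lie strictly above the minimum of `δ` in every order, since `i ≠ j`,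
  -- against the dominance of `δ`.
  have hyz : y ≠ z := by
    rintro rfl
    obtain ⟨l, hl⟩ := hδ y
    have := hl _ (hmem l)
    by_cases h : l = i
    · exact absurd this (not_le.2 (hzi l (h ▸ hij)))
    · exact absurd this (not_le.2 (hyi l h))
  rw [card_eq_two]
  refine ⟨insert y δ, insert z δ, ?_, ?_⟩
  · intro h
    have : y ∈ insert z δ := h ▸ mem_insert_self _ _
    rcases mem_insert.1 this with h | h
    exacts [hyz h, hyδ h]
  ext ρ
  rw [hS, mem_insert, mem_singleton]
  constructor
  · rintro ⟨⟨hρ, hρc⟩, hsub⟩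
    obtain ⟨x, hx⟩ : ∃ x, ρ \ δ = {x} := by
      rw [← card_eq_one, card_sdiff_of_subset hsub]; omega
    have hxδ : x ∉ δ := by
      have : x ∈ ρ \ δ := hx ▸ mem_singleton_self x
      exact (mem_sdiff.1 this).2
    obtain rfl : ρ = insert x δ := by
      rw [← sdiff_union_of_subset hsub, hx]; rfl
    have hlt : ∀ l, ¬ r l x < r l (m l) → r l (m l) < r l x := fun l hl =>
      lt_of_le_of_ne (not_lt.1 hl) fun h => hxδ (hinj l h ▸ hmem l)
    obtain ⟨k, hk⟩ := hρ x
    have hkx : r k x < r k (m k) := lt_of_le_of_ne (hk _ (mem_insert_of_mem (hmem k)))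
      fun h => hxδ (hinj k h ▸ hmem k)
    -- Each old point must remain the minimum in some order. As `δ` has `card I - 1` points, `x`
    -- takes over exactly one order `k`, and `m` is injective on the others; hence `k` is `i` or
    -- `j`.
    have himg : δ ⊆ (univ.filter fun l => ¬ r l x < r l (m l)).image m := by
      intro s hs
      obtain ⟨l, hl⟩ := hρ s
      have hml : m l = s :=
        hinj l (le_antisymm (hmle l s hs) (hl _ (mem_insert_of_mem (hmem l))))
      refine mem_image.2 ⟨l, ?_, hml⟩
      simp only [mem_filter, mem_univ, true_and, not_lt, hml]
      exact hl x (mem_insert_self _ _)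
    have h1 := card_le_card himg
    have h2 : #((univ.filter fun l => ¬ r l x < r l (m l)).image m) ≤ _ := card_image_le
    have h3 : (univ.filter fun l => ¬ r l x < r l (m l)) ⊆ univ.erase k := by
      intro l hl
      simp only [mem_filter, mem_univ, true_and] at hl
      exact mem_erase.2 ⟨fun h => hl (h ▸ hkx), mem_univ _⟩
    have h4 : #(univ.erase k) + 1 = Fintype.card I := by
      rw [card_erase_add_one (mem_univ k), card_univ]
    have h5 : (univ.filter fun l => ¬ r l x < r l (m l)) = univ.erase k :=
      eq_of_subset_of_card_le h3 (by omega)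
    have hxk : ∀ l, l ≠ k → r l (m l) < r l x := fun l hl => hlt l (by
      have : l ∈ univ.erase k := mem_erase.2 ⟨hl, mem_univ _⟩
      rw [← h5] at this
      exact (mem_filter.1 this).2)
    have hinjOn : Set.InjOn m (univ.erase k : Finset I) := by
      rw [← card_image_iff]
      have : #((univ.erase k).image m) ≤ _ := card_image_le
      rw [h5] at h1
      omega
    have hkij : k = i ∨ k = j := by
      by_contra! h
      exact hij (hinjOn (by simpa using h.1.symm) (by simpa using h.2.symm) hm)
    rcases hkij with rfl | rfl
    · left; rw [hyu x ⟨hxδ, hρ, hxk⟩]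
    · right; rw [hzu x ⟨hxδ, hρ, hxk⟩]
  · rintro (rfl | rfl)
    · exact ⟨⟨hyd, by rw [card_insert_of_notMem hyδ, hcard]⟩, subset_insert _ _⟩
    · exact ⟨⟨hzd, by rw [card_insert_of_notMem hzδ, hcard]⟩, subset_insert _ _⟩

open Finset in
/-- The number of facets with colors `univ.erase i₀` of a set with `card I` elements that does not
have all the colors is even. -/
theorem even_card_facets [Fintype I] [DecidableEq I] [DecidableEq Y] (c : Y → I) (i₀ : I)
    {ρ : Finset Y} (hρ : #ρ = Fintype.card I) (hc : ρ.image c ≠ univ) :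
    Even #(ρ.filter fun y => (ρ.erase y).image c = univ.erase i₀) := by
  classical
  rcases (ρ.filter fun y => (ρ.erase y).image c = univ.erase i₀).eq_empty_or_nonempty with h | h
  · simp [h]
  obtain ⟨y, hy⟩ := h
  obtain ⟨hyρ, hyc⟩ := mem_filter.1 hy
  have hcI : #(univ.erase i₀) + 1 = Fintype.card I := by
    rw [card_erase_add_one (mem_univ i₀), card_univ]
  have hinj : ∀ x ∈ ρ, (ρ.erase x).image c = univ.erase i₀ → Set.InjOn c (ρ.erase x) := by
    intro x hx hxc
    rw [← card_image_iff, hxc]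
    have := card_erase_add_one hx
    omega
  have himg : ∀ x ∈ ρ, ρ.image c = insert (c x) ((ρ.erase x).image c) := by
    intro x hx
    rw [← image_insert, insert_erase hx]
  have hcy : c y ≠ i₀ := by
    intro h
    apply hc
    rw [himg y hyρ, hyc, h, insert_erase (mem_univ _)]
  -- The color of `y` is repeated at exactly one other point `z`, and only removing `y` or `z`
  -- leaves the required colors.
  have : c y ∈ (ρ.erase y).image c := by rw [hyc]; simpa using hcy
  obtain ⟨z, hz, hzc⟩ := mem_image.1 this
  obtain ⟨hzy, hzρ⟩ := mem_erase.1 hz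
  have hzimg : (ρ.erase z).image c = univ.erase i₀ := by
    rw [← hyc]
    ext k
    simp only [mem_image, mem_erase]
    constructor
    · rintro ⟨x, ⟨hxz, hx⟩, rfl⟩
      by_cases hxy : x = y
      · exact ⟨z, ⟨hzy, hzρ⟩, by rw [hzc, hxy]⟩
      · exact ⟨x, ⟨hxy, hx⟩, rfl⟩
    · rintro ⟨x, ⟨hxy, hx⟩, rfl⟩
      by_cases hxz : x = z
      · exact ⟨y, ⟨hzy.symm, hyρ⟩, by rw [hxz, hzc]⟩
      · exact ⟨x, ⟨hxz, hx⟩, rfl⟩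
  have : (ρ.filter fun y => (ρ.erase y).image c = univ.erase i₀) = {y, z} := by
    ext x
    simp only [mem_filter, mem_insert, mem_singleton]
    constructor
    · rintro ⟨hx, hxc⟩
      by_contra! h
      exact hzy (hinj x hx hxc (by simp [hzρ, h.2.symm]) (by simp [hyρ, h.1.symm]) hzc)
    · rintro (rfl | rfl)
      exacts [⟨hyρ, hyc⟩, ⟨hzρ, hzimg⟩]
  rw [this, card_pair hzy.symm]
  exact even_two

open Finset in
/-- The dominant sets that complete the set of all `p l` with `l ≠ i₀`. -/
theorem card_dominant_superset_eq_one [Fintype I] [DecidableEq I] [Fintype Y] [DecidableEq Y]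
    {r : I → Y → ℕ} (hinj : ∀ i, Function.Injective (r i)) {p : I → Y} (hpinj : p.Injective)
    (hbot : ∀ i y, r i (p i) ≤ r i y)
    (htop : ∀ i l y, i ≠ l → y ∉ Set.range p → r i y < r i (p l))
    {y₀ : Y} (hy₀ : y₀ ∉ Set.range p) (i₀ : I) (S : Finset (Finset Y))
    (hS : ∀ ρ, ρ ∈ S ↔ (Dominant r ρ ∧ #ρ = Fintype.card I) ∧ (univ.erase i₀).image p ⊆ ρ) :
    #S = 1 := by
  classical
  set δ := (univ.erase i₀).image p with hδ
  have hcard : #δ + 1 = Fintype.card I := by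
    rw [card_image_of_injective _ hpinj, card_erase_add_one (mem_univ i₀), card_univ]
  have hmem : ∀ l, l ≠ i₀ → p l ∈ δ := fun l hl => mem_image_of_mem _ (by simpa using hl)
  obtain ⟨y, hy, hmax⟩ := exists_max_image (univ.filter fun y => y ∉ Set.range p) (r i₀)
    ⟨y₀, by simpa using hy₀⟩
  simp only [mem_filter, mem_univ, true_and] at hy hmax
  have hpδ : ∀ x, x ∉ Set.range p → x ∉ δ := by
    intro x hx h
    obtain ⟨l, -, rfl⟩ := mem_image.1 h
    exact hx ⟨l, rfl⟩
  have hlt : ∀ l x, x ∉ Set.range p → r l (p l) < r l x := fun l x hx =>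
    lt_of_le_of_ne (hbot l x) fun h => hx ⟨l, hinj l h⟩
  rw [card_eq_one]
  refine ⟨insert y δ, ?_⟩
  ext ρ
  rw [hS, mem_singleton]
  constructor
  · rintro ⟨⟨hρ, hρc⟩, hsub⟩
    obtain ⟨x, hx⟩ : ∃ x, ρ \ δ = {x} := by
      rw [← card_eq_one, card_sdiff_of_subset hsub]; omega
    obtain rfl : ρ = insert x δ := by
      rw [← sdiff_union_of_subset hsub, hx]; rfl
    -- In an order `l ≠ i₀` the bottom element `p l` belongs to `δ`, so only `i₀` can witness
    -- dominance over a point outside the range of `p`.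
    have key : ∀ z, z ∉ Set.range p → r i₀ z ≤ r i₀ x := by
      intro z hz
      obtain ⟨l, hl⟩ := hρ z
      by_cases h : l = i₀
      · exact h ▸ hl x (mem_insert_self _ _)
      · exact absurd (hl _ (mem_insert_of_mem (hmem l h))) (not_le.2 (hlt l z hz))
    have hxp : x ∉ Set.range p := by
      rintro ⟨l, rfl⟩
      have hl : l = i₀ := by
        by_contra h
        have : p l ∈ insert (p l) δ \ δ := hx ▸ mem_singleton_self _
        exact (mem_sdiff.1 this).2 (hmem l h)
      subst hl
      exact absurd (key y₀ hy₀) (not_le.2 (hlt _ _ hy₀))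
    rw [hinj i₀ (le_antisymm (hmax x hxp) (key y hy))]
  · rintro rfl
    refine ⟨⟨?_, by rw [card_insert_of_notMem (hpδ y hy), hcard]⟩, subset_insert _ _⟩
    intro x
    by_cases hx : x ∈ Set.range p
    · obtain ⟨l, rfl⟩ := hx
      exact ⟨l, fun s _ => hbot l s⟩
    · refine ⟨i₀, fun s hs => ?_⟩
      rcases mem_insert.1 hs with rfl | hs
      · exact hmax x hx
      · obtain ⟨l, hl, rfl⟩ := mem_image.1 hs
        exact (htop i₀ l x (Ne.symm (by simpa using hl)) hx).le

open Finset in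
/-- **Scarf's combinatorial lemma**: there is a dominant set carrying all the colors. -/
theorem exists_dominant_colorful [Fintype I] [DecidableEq I] [Nonempty I] [Fintype Y]
    [DecidableEq Y] {r : I → Y → ℕ} (hinj : ∀ i, Function.Injective (r i)) {p : I → Y}
    (hbot : ∀ i y, r i (p i) ≤ r i y)
    (htop : ∀ i l y, i ≠ l → y ∉ Set.range p → r i y < r i (p l))
    {y₀ : Y} (hy₀ : y₀ ∉ Set.range p) {c : Y → I} (hc : ∀ i, c (p i) = i) :
    ∃ ρ : Finset Y, Dominant r ρ ∧ ρ.image c = univ := by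
  classical
  obtain ⟨i₀⟩ := ‹Nonempty I›
  have hpinj : p.Injective := Function.LeftInverse.injective hc
  have hcI : #(univ.erase i₀) + 1 = Fintype.card I := by
    rw [card_erase_add_one (mem_univ i₀), card_univ]
  by_contra! hno
  let R : Finset (Finset Y) := univ.filter fun ρ => Dominant r ρ ∧ #ρ = Fintype.card I
  let D : Finset (Finset Y) := univ.filter fun δ =>
    (Dominant r δ ∧ #δ + 1 = Fintype.card I) ∧ δ.image c = univ.erase i₀
  -- Incidences between `D` and `R` are counted twice. Without a colorful set, each member of `R`
  -- has evenly many facets in `D`; each member of `D` lies in two members of `R`, except the face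
  -- spanned by the `p l` with `l ≠ i₀`, which lies in one.
  have hcount := sum_card_bipartiteAbove_eq_sum_card_bipartiteBelow (s := D) (t := R)
    (fun δ ρ => δ ⊆ ρ)
  have hR : Even (∑ ρ ∈ R, #(bipartiteBelow (fun δ ρ => δ ⊆ ρ) D ρ)) := by
    refine even_sum _ fun ρ hρ => ?_
    simp only [R, mem_filter, mem_univ, true_and] at hρ
    have := even_card_facets c i₀ hρ.2 (hno ρ hρ.1)
    suffices h : #(ρ.filter fun y => (ρ.erase y).image c = univ.erase i₀) =
        #(bipartiteBelow (fun δ ρ => δ ⊆ ρ) D ρ) by rwa [← h]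
    refine card_bij (fun y _ => ρ.erase y) ?_ ?_ ?_
    · intro y hy
      obtain ⟨hyρ, hyc⟩ := mem_filter.1 hy
      simp only [bipartiteBelow, D, mem_filter, mem_univ, true_and]
      exact ⟨⟨⟨hρ.1.mono (erase_subset _ _), by rw [card_erase_add_one hyρ, hρ.2]⟩, hyc⟩,
        erase_subset _ _⟩
    · intro y hy z hz h
      exact (erase_inj ρ (mem_filter.1 hy).1).1 h
    · intro δ hδ
      simp only [bipartiteBelow, D, mem_filter, mem_univ, true_and] at hδ
      obtain ⟨⟨⟨-, hcard⟩, himg⟩, hsub⟩ := hδ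
      obtain ⟨x, hx⟩ : ∃ x, ρ \ δ = {x} := by
        rw [← card_eq_one, card_sdiff_of_subset hsub]; omega
      have hxm : x ∈ ρ \ δ := hx ▸ mem_singleton_self x
      have hδ : ρ.erase x = δ := by
        rw [erase_eq, ← hx, Finset.sdiff_sdiff_eq_self hsub]
      exact ⟨x, mem_filter.2 ⟨(mem_sdiff.1 hxm).1, by rw [hδ, himg]⟩, hδ⟩
  have hD₀ : (univ.erase i₀).image p ∈ D := by
    simp only [D, mem_filter, mem_univ, true_and]
    refine ⟨⟨?_, by rw [card_image_of_injective _ hpinj, hcI]⟩, ?_⟩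
    · intro x
      by_cases hx : x ∈ Set.range p
      · obtain ⟨l, rfl⟩ := hx
        exact ⟨l, fun s _ => hbot l s⟩
      · refine ⟨i₀, fun s hs => ?_⟩
        obtain ⟨l, hl, rfl⟩ := mem_image.1 hs
        exact (htop i₀ l x (Ne.symm (by simpa using hl)) hx).le
    · rw [image_image, show c ∘ p = id from funext hc, image_id]
  rw [← add_sum_erase _ _ hD₀] at hcount
  have h1 : #(bipartiteAbove (fun δ ρ => δ ⊆ ρ) R ((univ.erase i₀).image p)) = 1 :=
    card_dominant_superset_eq_one hinj hpinj hbot htop hy₀ i₀ _ fun ρ => by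
      simp [bipartiteAbove, R]
  have h2 : Even (∑ δ ∈ D.erase ((univ.erase i₀).image p),
      #(bipartiteAbove (fun δ ρ => δ ⊆ ρ) R δ)) := by
    refine even_sum _ fun δ hδ => ?_
    obtain ⟨hne, hδ⟩ := mem_erase.1 hδ
    simp only [D, mem_filter, mem_univ, true_and] at hδ
    obtain ⟨⟨hdom, hcard⟩, himg⟩ := hδ
    obtain ⟨w, hw, hwp⟩ : ∃ w ∈ δ, w ∉ Set.range p := by
      by_contra! h
      apply hne
      have hpc : ∀ x ∈ δ, p (c x) = x := by
        intro x hx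
        obtain ⟨l, rfl⟩ := h x hx
        rw [hc]
      rw [← himg, image_image]
      ext x
      simp only [mem_image, Function.comp]
      exact ⟨fun hx => ⟨x, hx, hpc x hx⟩, by rintro ⟨y, hy, rfl⟩; rwa [hpc y hy]⟩
    rw [card_dominant_superset_eq_two hinj hdom hcard hw (p := p)
      (fun i l hil => htop i l w hil hwp) _ fun ρ => by simp [bipartiteAbove, R]]
    exact even_two
  rw [← hcount, h1] at hR
  exact absurd hR (by rw [Nat.not_even_iff_odd]; exact odd_one.add_even h2)

end Scarf

/-! ### Brouwer's theorem on the standard simplex. -/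

section Brouwer

variable {I : Type*} [Fintype I]

/-- The grid points of the standard simplex with denominator `m`, scaled by `m`. -/
abbrev SimplexGrid (I : Type*) [Fintype I] (m : ℕ) : Type _ :=
  {x : I → Fin (m + 1) // ∑ i, (x i : ℕ) = m}

/-- The point of the standard simplex given by a grid point. -/
noncomputable def SimplexGrid.toSimplex {m : ℕ} (hm : 0 < m) (x : SimplexGrid I m) :
    stdSimplex ℝ I :=
  ⟨fun i => (x.1 i : ℕ) / (m : ℝ), fun i => by positivity, by
    rw [← Finset.sum_div, ← Nat.cast_sum, x.2, div_self (by positivity)]⟩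

open Finset in
theorem SimplexGrid.exists_ge [Nonempty I] {m : ℕ} (b : I → ℕ) (hb : ∑ i, b i ≤ m) :
    ∃ x : SimplexGrid I m, ∀ i, b i ≤ x.1 i := by
  classical
  obtain ⟨k⟩ := ‹Nonempty I›
  let y : I → ℕ := b + Pi.single k (m - ∑ i, b i)
  have hy : ∑ i, y i = m := by
    simp only [y, Pi.add_apply, sum_add_distrib, sum_pi_single', mem_univ, if_true]
    omega
  have hle : ∀ i, y i ≤ m := fun i => hy ▸ single_le_sum (fun _ _ => Nat.zero_le _) (mem_univ i)
  exact ⟨⟨fun i => ⟨y i, Nat.lt_succ_of_le (hle i)⟩, hy⟩, fun i => by simp [y]⟩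

open Finset in
/-- For every coloring of the grid by coordinates there is a family of grid points within bounded
distance from each other that contains every color `i`, unless the `i`-th coordinates in the family
are bounded. -/
theorem SimplexGrid.exists_colorful [Nonempty I] {m : ℕ} (c : SimplexGrid I m → I) :
    ∃ (σ : Finset (SimplexGrid I m)) (a : I → ℕ), σ.Nonempty ∧
      (∀ s ∈ σ, ∀ i, a i ≤ s.1 i ∧ (s.1 i : ℕ) ≤ a i + Fintype.card I) ∧
      ∀ i, a i = 0 ∨ ∃ s ∈ σ, c s = i := by
  classical
  let X := SimplexGrid I m
  let k := Fintype.card X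
  let e : X ≃ Fin k := Fintype.equivFin X
  let e' : I ≃ Fin (Fintype.card I) := Fintype.equivFin I
  -- Grid points are ranked by their `i`-th coordinate, ties being broken by the enumeration `e`.
  -- The auxiliary point `inr i` is last in order `i`, and the other auxiliary points exceed the
  -- whole grid.
  let r : I → X ⊕ I → ℕ := fun i => Sum.elim (fun x => 1 + ((x.1 i : ℕ) * k + e x))
    (fun l => if l = i then 0 else 1 + ((m + 1) * k + e' l))
  have hrx : ∀ i (x : X), r i (.inl x) < 1 + (m + 1) * k := by
    intro i x
    have h1 : (x.1 i : ℕ) * k ≤ m * k := Nat.mul_le_mul_right _ (Nat.lt_succ_iff.1 (x.1 i).2)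
    have h2 := (e x).2
    simp only [r, Sum.elim_inl]
    rw [add_mul, one_mul]
    omega
  have hinj : ∀ i, Function.Injective (r i) := by
    intro i
    rintro (x | l) (y | l') h
    · have h' : (x.1 i : ℕ) * k + e x = (y.1 i : ℕ) * k + e y := by
        simpa [r] using h
      have hmod := congrArg (· % k) h'
      simp only [Nat.mul_add_mod_self_right, Nat.mod_eq_of_lt (e x).2,
        Nat.mod_eq_of_lt (e y).2] at hmod
      rw [e.injective (Fin.ext hmod)]
    · exfalso
      have := hrx i x
      rw [h] at this
      by_cases hl : l' = i
      · simp [r, hl] at h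
      · simp [r, hl] at this
    · exfalso
      have := hrx i y
      rw [← h] at this
      by_cases hl : l = i
      · simp [r, hl] at h
        omega
      · simp [r, hl] at this
    · by_cases hl : l = i <;> by_cases hl' : l' = i
      · rw [hl, hl']
      · simp [r, hl, hl'] at h
        omega
      · simp [r, hl, hl'] at h
      · have : (e' l : ℕ) = e' l' := by simpa [r, hl, hl'] using h
        rw [e'.injective (Fin.ext this)]
  obtain ⟨x₀, -⟩ := SimplexGrid.exists_ge (m := m) (fun _ : I => 0) (by simp)
  have hxp : ∀ x : X, (.inl x : X ⊕ I) ∉ Set.range (.inr : I → X ⊕ I) := by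
    rintro x ⟨l, hl⟩
    simp at hl
  have hbot : ∀ i y, r i (.inr i) ≤ r i y := fun i y => by simp [r]
  obtain ⟨ρ, hρ, himg⟩ := exists_dominant_colorful hinj (p := Sum.inr) (y₀ := .inl x₀)
    (c := Sum.elim c id) hbot (by
      rintro i l (x | l') hil hy
      · refine (hrx i x).trans_le ?_
        simp only [r, Sum.elim_inr, if_neg hil.symm]
        omega
      · exact absurd ⟨l', rfl⟩ hy) (hxp x₀) (fun i => rfl)
  let σ : Finset X := univ.filter fun x => Sum.inl x ∈ ρ
  have hσ : ∀ x, x ∈ σ ↔ Sum.inl x ∈ ρ := fun x => by simp [σ]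
  have hdom : ∀ y : X, ∃ i, Sum.inr i ∉ ρ ∧ ∀ s ∈ σ, (y.1 i : ℕ) ≤ s.1 i := by
    intro y
    obtain ⟨i, hi⟩ := hρ (.inl y)
    refine ⟨i, fun h => ?_, fun s hs => ?_⟩
    · have := hi _ h
      simp [r] at this
    · have h1 := hi _ ((hσ s).1 hs)
      simp only [r, Sum.elim_inl] at h1
      by_contra! h
      have h2 : ((s.1 i : ℕ) + 1) * k ≤ (y.1 i : ℕ) * k := Nat.mul_le_mul_right _ h
      rw [add_mul, one_mul] at h2
      have := (e s).2
      omega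
  have hcol : ∀ i, Sum.inr i ∈ ρ ∨ ∃ s ∈ σ, c s = i := by
    intro i
    have : i ∈ ρ.image (Sum.elim c id) := himg ▸ mem_univ i
    obtain ⟨x | l, hx, hxi⟩ := mem_image.1 this
    · exact .inr ⟨x, (hσ x).2 hx, hxi⟩
    · obtain rfl : l = i := hxi
      exact .inl hx
  have hne : σ.Nonempty := by
    obtain ⟨i, hi, -⟩ := hdom x₀
    obtain ⟨s, hs, -⟩ := (hcol i).resolve_left hi
    exact ⟨s, hs⟩
  have hmin : ∀ i, ∃ t ∈ σ, ∀ s ∈ σ, (t.1 i : ℕ) ≤ s.1 i := fun i =>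
    exists_min_image σ (fun s => (s.1 i : ℕ)) hne
  choose t ht hmin using hmin
  let a : I → ℕ := fun i => if Sum.inr i ∈ ρ then 0 else ((t i).1 i : ℕ)
  have ha : ∀ s ∈ σ, ∀ i, a i ≤ s.1 i := by
    intro s hs i
    simp only [a]
    split_ifs
    exacts [Nat.zero_le _, hmin i s hs]
  -- Otherwise some grid point would exceed `a` by at least one in every coordinate, contradicting
  -- dominance. This bounds the spread: the excesses of any `s ∈ σ` over `a` add up to less than
  -- `card I`.
  have hsum : m < ∑ i, a i + Fintype.card I := by
    by_contra! h
    obtain ⟨y, hy⟩ := SimplexGrid.exists_ge (m := m) (fun i => a i + 1) (by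
      rw [sum_add_distrib]; simpa using h)
    obtain ⟨i, hi, hle⟩ := hdom y
    have h1 := hy i
    have h2 := hle _ (ht i)
    simp only [a, if_neg hi] at h1
    omega
  refine ⟨σ, a, hne, fun s hs i => ⟨ha s hs i, ?_⟩, fun i => ?_⟩
  · have h1 : (s.1 i : ℕ) + ∑ j ∈ univ.erase i, (s.1 j : ℕ) = m :=
      (add_sum_erase _ _ (mem_univ i)).trans s.2
    have h2 : a i + ∑ j ∈ univ.erase i, a j = ∑ j, a j := add_sum_erase _ _ (mem_univ i)
    have h3 : ∑ j ∈ univ.erase i, a j ≤ ∑ j ∈ univ.erase i, (s.1 j : ℕ) :=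
      sum_le_sum fun j _ => ha s hs j
    omega
  · rcases hcol i with h | h
    · exact .inl (by simp [a, h])
    · exact .inr h

open Finset in
-- A point is colored by a coordinate that `f` does not decrease; one exists because coordinates sum
-- to one. A color missing from the colorful family belongs to a coordinate that is already small.
-- The point `y` may depend on `i`, which is harmless in the limit.
theorem exists_approx_fixedPoint [Nonempty I] (f : stdSimplex ℝ I → stdSimplex ℝ I) {m : ℕ}
    (hm : 0 < m) : ∃ x : stdSimplex ℝ I, ∀ i, ∃ y : stdSimplex ℝ I,
      (∀ j, |y.1 j - x.1 j| ≤ Fintype.card I / (m : ℝ)) ∧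
      x.1 i ≤ (f y).1 i + Fintype.card I / (m : ℝ) := by
  classical
  have hc : ∀ x : stdSimplex ℝ I, ∃ i, x.1 i ≤ (f x).1 i := by
    intro x
    by_contra! h
    have := sum_lt_sum_of_nonempty (s := univ) univ_nonempty fun i _ => h i
    rw [x.2.2, (f x).2.2] at this
    exact lt_irrefl _ this
  choose c hc using hc
  obtain ⟨σ, a, ⟨s, hs⟩, hσ, hcol⟩ :=
    SimplexGrid.exists_colorful (fun x : SimplexGrid I m => c (x.toSimplex hm))
  have hm' : (0 : ℝ) < m := by exact_mod_cast hm
  have hclose : ∀ u ∈ σ, ∀ v ∈ σ, ∀ j,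
      (u.toSimplex hm).1 j - (v.toSimplex hm).1 j ≤ Fintype.card I / (m : ℝ) := by
    intro u hu v hv j
    have h : (u.1 j : ℕ) ≤ (v.1 j : ℕ) + Fintype.card I := by
      have := (hσ u hu j).2
      have := (hσ v hv j).1
      omega
    have h' : ((u.1 j : ℕ) : ℝ) ≤ (v.1 j : ℕ) + Fintype.card I := by exact_mod_cast h
    change ((u.1 j : ℕ) : ℝ) / m - ((v.1 j : ℕ) : ℝ) / m ≤ _
    rw [← sub_div]
    gcongr
    linarith
  have habs : ∀ u ∈ σ, ∀ v ∈ σ, ∀ j,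
      |(u.toSimplex hm).1 j - (v.toSimplex hm).1 j| ≤ Fintype.card I / (m : ℝ) :=
    fun u hu v hv j => abs_sub_le_iff.2 ⟨hclose u hu v hv j, hclose v hv u hu j⟩
  refine ⟨s.toSimplex hm, fun i => ?_⟩
  rcases hcol i with h | ⟨t, ht, hti⟩
  · refine ⟨s.toSimplex hm, habs s hs s hs, ?_⟩
    have h1 : ((s.1 i : ℕ) : ℝ) ≤ Fintype.card I := by
      have := (hσ s hs i).2
      rw [h, zero_add] at this
      exact_mod_cast this
    have h2 : (s.toSimplex hm).1 i ≤ Fintype.card I / (m : ℝ) := by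
      change ((s.1 i : ℕ) : ℝ) / m ≤ _
      gcongr
    linarith [(f (s.toSimplex hm)).2.1 i]
  · refine ⟨t.toSimplex hm, habs t ht s hs, ?_⟩
    have h1 := hc (t.toSimplex hm)
    rw [hti] at h1
    linarith [hclose s hs t ht i]

open Filter Topology in
/-- **Brouwer's fixed point theorem** for the standard simplex. -/
theorem stdSimplex.exists_fixedPoint [Nonempty I] {f : stdSimplex ℝ I → stdSimplex ℝ I}
    (hf : Continuous f) : ∃ x, f x = x := by
  have h : ∀ n : ℕ, _ := fun n => exists_approx_fixedPoint f (Nat.succ_pos n)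
  choose x y hy hx using h
  have : CompactSpace (stdSimplex ℝ I) :=
    isCompact_iff_compactSpace.1 (isCompact_stdSimplex ℝ I)
  let U : Ultrafilter ℕ := hyperfilter ℕ
  have hU : (U : Filter ℕ) ≤ atTop := Nat.hyperfilter_le_atTop
  obtain ⟨z, hz⟩ : ∃ z, Tendsto x U (𝓝 z) := ⟨_, (U.map x).le_nhds_lim⟩
  have hε : Tendsto (fun n : ℕ => (Fintype.card I : ℝ) / ((n.succ : ℕ) : ℝ)) U (𝓝 0) :=
    ((tendsto_const_div_atTop_nhds_zero_nat (Fintype.card I : ℝ)).comp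
      (tendsto_add_atTop_nat 1)).mono_left hU
  have hzc : ∀ j, Tendsto (fun n => (x n).1 j) U (𝓝 (z.1 j)) := fun j =>
    (((continuous_apply j).comp continuous_subtype_val).tendsto z).comp hz
  have hyz : ∀ i, Tendsto (fun n => y n i) U (𝓝 z) := by
    intro i
    rw [tendsto_subtype_rng, tendsto_pi_nhds]
    intro j
    have h0 : Tendsto (fun n => (y n i).1 j - (x n).1 j) U (𝓝 0) :=
      squeeze_zero_norm (fun n => hy n i j) hε
    simpa using h0.add (hzc j)
  have hle : ∀ i, z.1 i ≤ (f z).1 i := by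
    intro i
    have h1 : Tendsto (fun n => (f (y n i)).1 i) U (𝓝 ((f z).1 i)) :=
      (((continuous_apply i).comp (continuous_subtype_val.comp hf)).tendsto z).comp (hyz i)
    have h2 := le_of_tendsto_of_tendsto' (hzc i) (h1.add hε) fun n => hx n i
    simpa using h2
  refine ⟨z, Subtype.ext (funext fun i => ?_)⟩
  -- Equal total mass turns the coordinatewise inequalities into equalities.
  have hs : ∑ i, z.1 i = ∑ i, (f z).1 i := by rw [z.2.2, (f z).2.2]
  exact ((Finset.sum_eq_sum_iff_of_le fun i _ => hle i).1 hs i (Finset.mem_univ i)).symm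

end Brouwer

/-! ### Fixed points on finite and infinite products of simplices. -/

section FixedPoint

open Filter Topology

instance stdSimplex.instCompactSpaceReal {α : Type*} [Fintype α] :
    CompactSpace (stdSimplex ℝ α) :=
  isCompact_iff_compactSpace.1 (isCompact_stdSimplex ℝ α)

theorem continuous_stdSimplex_mk {α Z : Type*} [Fintype α] [TopologicalSpace Z]
    {x : Z → stdSimplex ℝ α} (h : ∀ a, Continuous fun z => (x z).1 a) : Continuous x :=
  continuous_induced_rng.2 (continuous_pi h)

theorem continuous_stdSimplex_coord {α : Type*} [Fintype α] (a : α) :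
    Continuous fun x : stdSimplex ℝ α => x.1 a :=
  (continuous_apply a).comp continuous_subtype_val

theorem stdSimplex_nonempty {α : Type*} [Fintype α] [Nonempty α] : Nonempty (stdSimplex ℝ α) := by
  classical
  exact ⟨⟨_, single_mem_stdSimplex ℝ (Classical.arbitrary α)⟩⟩

variable {I : Type*} {A : I → Type*} [∀ i, Fintype (A i)]

/-- A product of simplices is embedded into the simplex of the disjoint union, by uniform weights. -/
noncomputable def piToSigmaSimplex [Fintype I] [Nonempty I] (x : ∀ i, stdSimplex ℝ (A i)) :
    stdSimplex ℝ (Σ i, A i) :=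
  ⟨fun z => (x z.1).1 z.2 / Fintype.card I,
    fun z => div_nonneg ((x z.1).2.1 z.2) (Nat.cast_nonneg _), by
    rw [Fintype.sum_sigma]
    simp_rw [← Finset.sum_div, (x _).2.2]
    simp⟩

/-- A left inverse of `piToSigmaSimplex`. -/
noncomputable def sigmaToPiSimplex [Fintype I] [Nonempty I] [∀ i, Nonempty (A i)]
    (w : stdSimplex ℝ (Σ i, A i)) (i : I) : stdSimplex ℝ (A i) :=
  -- A block of mass below `1 / card I` is filled up uniformly, then normalized. The denominator
  -- stays positive, so the map is continuous even where a block has mass zero.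
  ⟨fun a => (w.1 ⟨i, a⟩ +
      max ((Fintype.card I : ℝ)⁻¹ - ∑ b, w.1 ⟨i, b⟩) 0 / Fintype.card (A i)) /
      max (∑ b, w.1 ⟨i, b⟩) (Fintype.card I : ℝ)⁻¹,
    fun a => by
      have := w.2.1 ⟨i, a⟩
      positivity, by
    have hn : (0 : ℝ) < (Fintype.card I : ℝ)⁻¹ := by
      have := Fintype.card_pos (α := I)
      positivity
    have hA : (Fintype.card (A i) : ℝ) ≠ 0 := by
      have := Fintype.card_pos (α := A i)
      positivity
    have hmax : 0 < max (∑ b, w.1 ⟨i, b⟩) (Fintype.card I : ℝ)⁻¹ := lt_max_of_lt_right hn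
    rw [← Finset.sum_div, Finset.sum_add_distrib, Finset.sum_const, Finset.card_univ, nsmul_eq_mul,
      mul_div_cancel₀ _ hA, div_eq_one_iff_eq hmax.ne']
    rcases le_total (∑ b, w.1 ⟨i, b⟩) (Fintype.card I : ℝ)⁻¹ with h | h
    · rw [max_eq_left (sub_nonneg.2 h), max_eq_right h]; ring
    · rw [max_eq_right (sub_nonpos.2 h), max_eq_left h]; ring⟩

theorem sigmaToPiSimplex_piToSigmaSimplex [Fintype I] [Nonempty I] [∀ i, Nonempty (A i)]
    (x : ∀ i, stdSimplex ℝ (A i)) : sigmaToPiSimplex (piToSigmaSimplex x) = x := by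
  have hn : (Fintype.card I : ℝ) ≠ 0 := by
    have := Fintype.card_pos (α := I)
    positivity
  funext i
  have hs : ∑ b, (piToSigmaSimplex x).1 ⟨i, b⟩ = (Fintype.card I : ℝ)⁻¹ := by
    simp only [piToSigmaSimplex]
    rw [← Finset.sum_div, (x i).2.2, one_div]
  refine Subtype.ext (funext fun a => ?_)
  simp only [sigmaToPiSimplex, hs]
  simp only [piToSigmaSimplex, sub_self, max_self, zero_div, add_zero]
  field_simp

theorem continuous_piToSigmaSimplex [Fintype I] [Nonempty I] :
    Continuous (piToSigmaSimplex (A := A)) :=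
  continuous_stdSimplex_mk fun z =>
    ((continuous_stdSimplex_coord z.2).comp (continuous_apply z.1)).div_const _

theorem continuous_sigmaToPiSimplex [Fintype I] [Nonempty I] [∀ i, Nonempty (A i)] :
    Continuous (sigmaToPiSimplex (A := A)) := by
  refine continuous_pi fun i => continuous_stdSimplex_mk fun a => ?_
  have hn : (0 : ℝ) < (Fintype.card I : ℝ)⁻¹ := by
    have := Fintype.card_pos (α := I)
    positivity
  have hs : Continuous fun w : stdSimplex ℝ (Σ i, A i) => ∑ b, w.1 ⟨i, b⟩ :=
    continuous_finsetSum _ fun b _ => continuous_stdSimplex_coord _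
  exact ((continuous_stdSimplex_coord _).add
    (((continuous_const.sub hs).max continuous_const).div_const _)).div
    (hs.max continuous_const) fun w => (lt_max_of_lt_right hn).ne'

/-- Brouwer's fixed point theorem for finite products of simplices. -/
theorem exists_fixedPoint_pi_of_fintype [Fintype I] [∀ i, Nonempty (A i)]
    {f : (∀ i, stdSimplex ℝ (A i)) → ∀ i, stdSimplex ℝ (A i)} (hf : Continuous f) :
    ∃ x, f x = x := by
  rcases isEmpty_or_nonempty I with hI | hI
  · exact ⟨fun i => hI.elim i, funext fun i => hI.elim i⟩
  · have : Nonempty (Σ i, A i) := by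
      obtain ⟨i⟩ := hI
      exact ⟨⟨i, Classical.arbitrary _⟩⟩
    obtain ⟨w, hw⟩ := stdSimplex.exists_fixedPoint
      (continuous_piToSigmaSimplex.comp (hf.comp continuous_sigmaToPiSimplex))
    refine ⟨sigmaToPiSimplex w, ?_⟩
    conv_rhs => rw [← hw]
    exact (sigmaToPiSimplex_piToSigmaSimplex _).symm

/-- Brouwer's fixed point theorem for arbitrary products of simplices. -/
theorem exists_fixedPoint_pi [∀ i, Nonempty (A i)]
    {f : (∀ i, stdSimplex ℝ (A i)) → ∀ i, stdSimplex ℝ (A i)} (hf : Continuous f) :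
    ∃ x, f x = x := by
  classical
  let x₀ : ∀ i, stdSimplex ℝ (A i) := fun i => stdSimplex_nonempty.some
  -- Coordinates outside `F` are frozen at `x₀`; a limit along an ultrafilter finer than `atTop` on
  -- finite sets then fixes every coordinate.
  have key : ∀ F : Finset I, ∃ x : ∀ i, stdSimplex ℝ (A i), ∀ i ∈ F, f x i = x i := by
    intro F
    let ext : (∀ i : F, stdSimplex ℝ (A i)) → ∀ i, stdSimplex ℝ (A i) := fun x i =>
      if h : i ∈ F then x ⟨i, h⟩ else x₀ i
    have hext : Continuous ext := by
      refine continuous_pi fun i => ?_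
      by_cases h : i ∈ F
      · simpa [ext, h] using continuous_apply (⟨i, h⟩ : F)
      · simpa [ext, h] using continuous_const
    obtain ⟨x, hx⟩ := exists_fixedPoint_pi_of_fintype (A := fun i : F => A i)
      (f := fun x i => f (ext x) i)
      (continuous_pi fun i => (continuous_apply i.1).comp (hf.comp hext))
    refine ⟨ext x, fun i hi => ?_⟩
    have := congrFun hx ⟨i, hi⟩
    simp only at this
    rw [this]
    simp [ext, hi]
  choose x hx using key
  let U : Ultrafilter (Finset I) := Ultrafilter.of atTop
  have hU : (U : Filter (Finset I)) ≤ atTop := Ultrafilter.of_le _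
  obtain ⟨z, hz⟩ : ∃ z, Tendsto x U (𝓝 z) := by
    have : Nonempty (∀ i, stdSimplex ℝ (A i)) := ⟨x₀⟩
    exact ⟨_, (U.map x).le_nhds_lim⟩
  refine ⟨z, funext fun i => ?_⟩
  have h1 : Tendsto (fun F => f (x F) i) U (𝓝 (f z i)) :=
    (((continuous_apply i).comp hf).tendsto z).comp hz
  have h2 : Tendsto (fun F => x F i) U (𝓝 (z i)) := ((continuous_apply i).tendsto z).comp hz
  refine tendsto_nhds_unique_of_eventuallyEq h1 h2 (hU ?_)
  filter_upwards [eventually_ge_atTop {i}] with F hF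
  exact hx F i (hF (Finset.mem_singleton_self i))

end FixedPoint

/-! ### Nash's theorem. -/

section Nash

variable {α : Type*} [Fintype α]

/-- Nash's improvement map: the weight of the actions that do better than the mixed action `x`
against the payoffs `q` is increased. -/
noncomputable def nashStep (x : stdSimplex ℝ α) (q : α → ℝ) : stdSimplex ℝ α :=
  ⟨fun a => (x.1 a + max (q a - ∑ b, x.1 b * q b) 0) /
      (1 + ∑ c, max (q c - ∑ b, x.1 b * q b) 0), fun a => by
    have h1 := x.2.1 a
    have h2 : 0 ≤ ∑ c, max (q c - ∑ b, x.1 b * q b) 0 :=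
      Finset.sum_nonneg fun c _ => le_max_right _ _
    positivity, by
    have h2 : 0 ≤ ∑ c, max (q c - ∑ b, x.1 b * q b) 0 :=
      Finset.sum_nonneg fun c _ => le_max_right _ _
    rw [← Finset.sum_div, Finset.sum_add_distrib, x.2.2, div_self (by positivity)]⟩

theorem continuous_nashStep {Z : Type*} [TopologicalSpace Z] {x : Z → stdSimplex ℝ α}
    {q : Z → α → ℝ} (hx : Continuous x) (hq : ∀ a, Continuous fun z => q z a) :
    Continuous fun z => nashStep (x z) (q z) := by
  have hxa : ∀ a, Continuous fun z => (x z).1 a := fun a => (continuous_stdSimplex_coord a).comp hx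
  have hmean : Continuous fun z => ∑ b, (x z).1 b * q z b :=
    continuous_finsetSum _ fun b _ => (hxa b).mul (hq b)
  have hmax : ∀ a, Continuous fun z => max (q z a - ∑ b, (x z).1 b * q z b) 0 := fun a =>
    ((hq a).sub hmean).max continuous_const
  refine continuous_stdSimplex_mk fun a => ((hxa a).add (hmax a)).div
    (continuous_const.add (continuous_finsetSum _ fun c _ => hmax c)) fun z => ?_
  have h2 : 0 ≤ ∑ c, max (q z c - ∑ b, (x z).1 b * q z b) 0 :=
    Finset.sum_nonneg fun c _ => le_max_right _ _
  positivity

/-- At a fixed point the gains `max (q a - v) 0` equal `x a * S`. Hence the sum of their squares is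
`S * ∑ x a * (q a - v)`, which vanishes because `v` is the mean payoff. -/
theorem le_of_nashStep_eq {x : stdSimplex ℝ α} {q : α → ℝ} (h : nashStep x q = x) (a : α) :
    q a ≤ ∑ b, x.1 b * q b := by
  set v := ∑ b, x.1 b * q b with hv
  set S := ∑ c, max (q c - v) 0 with hS
  have hS0 : 0 ≤ S := Finset.sum_nonneg fun c _ => le_max_right _ _
  have hg : ∀ a, max (q a - v) 0 = x.1 a * S := by
    intro a
    have h1 : (x.1 a + max (q a - v) 0) / (1 + S) = x.1 a := congrFun (congrArg Subtype.val h) a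
    rw [div_eq_iff (by positivity)] at h1
    linarith
  have hsq : ∑ a, max (q a - v) 0 ^ 2 = 0 := by
    have h1 : ∀ a, max (q a - v) 0 ^ 2 = S * (x.1 a * q a) - S * v * x.1 a := by
      intro a
      have : max (q a - v) 0 ^ 2 = max (q a - v) 0 * (q a - v) := by
        rcases le_total (q a - v) 0 with h | h
        · rw [max_eq_right h]; ring
        · rw [max_eq_left h]; ring
      rw [this, hg]
      ring
    rw [Finset.sum_congr rfl fun a _ => h1 a, Finset.sum_sub_distrib, ← Finset.mul_sum,
      ← Finset.mul_sum, x.2.2, ← hv]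
    ring
  have h0 := (Finset.sum_eq_zero_iff_of_nonneg fun a _ => sq_nonneg _).1 hsq a (Finset.mem_univ a)
  have h1 : max (q a - v) 0 = 0 := by simpa using h0
  have := le_max_left (q a - v) 0
  linarith

/-- **Nash's theorem** for arbitrarily many agents with finitely many actions each: if the payoff of
every action of every agent depends continuously on the profile of mixed actions, then there is a
profile at which no agent has an action better than the average. -/
theorem exists_equilibrium_pi {I : Type*} {A : I → Type*} [∀ i, Fintype (A i)]
    [∀ i, Nonempty (A i)] (Q : ∀ i, A i → (∀ i, stdSimplex ℝ (A i)) → ℝ)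
    (hQ : ∀ i a, Continuous (Q i a)) :
    ∃ x, ∀ i a, Q i a x ≤ ∑ b, (x i).1 b * Q i b x := by
  obtain ⟨x, hx⟩ := exists_fixedPoint_pi (f := fun x i => nashStep (x i) fun a => Q i a x)
    (continuous_pi fun i => continuous_nashStep (continuous_apply i) (hQ i))
  exact ⟨x, fun i => le_of_nashStep_eq (congrFun hx i)⟩

/-- Nash's theorem for two families of agents. -/
theorem exists_equilibrium_prod {ι κ : Type*} {α β : Type} [Fintype α] [Nonempty α] [Fintype β]
    [Nonempty β] (P : ι → α → (ι → stdSimplex ℝ α) × (κ → stdSimplex ℝ β) → ℝ)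
    (hP : ∀ i a, Continuous (P i a)) (Q : κ → β → (ι → stdSimplex ℝ α) × (κ → stdSimplex ℝ β) → ℝ)
    (hQ : ∀ k b, Continuous (Q k b)) :
    ∃ z, (∀ i a, P i a z ≤ ∑ b, (z.1 i).1 b * P i b z) ∧
      ∀ k b, Q k b z ≤ ∑ c, (z.2 k).1 c * Q k c z := by
  let A : ι ⊕ κ → Type := Sum.elim (fun _ => α) fun _ => β
  let hA : ∀ i, Fintype (A i) := Sum.rec (fun _ => ‹Fintype α›) fun _ => ‹Fintype β›
  have hne : ∀ i, Nonempty (A i) := Sum.rec (fun _ => ‹Nonempty α›) fun _ => ‹Nonempty β›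
  let φ : (∀ i, stdSimplex ℝ (A i)) → (ι → stdSimplex ℝ α) × (κ → stdSimplex ℝ β) :=
    fun x => (fun i => x (.inl i), fun k => x (.inr k))
  have hφ : Continuous φ := (continuous_pi fun i => continuous_apply (Sum.inl i)).prodMk
    (continuous_pi fun k => continuous_apply (Sum.inr k))
  let R : ∀ i, A i → (∀ i, stdSimplex ℝ (A i)) → ℝ :=
    Sum.rec (fun i a x => P i a (φ x)) fun k b x => Q k b (φ x)
  have hR : ∀ i a, Continuous (R i a) :=
    Sum.rec (fun i a => (hP i a).comp hφ) fun k b => (hQ k b).comp hφ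
  obtain ⟨x, hx⟩ := exists_equilibrium_pi R hR
  exact ⟨φ x, fun i => hx (.inl i), fun k => hx (.inr k)⟩

/-- Every bimatrix game has an equilibrium in mixed strategies. -/
theorem exists_isBimatrixEquilibrium {ι κ : Type} [Fintype ι] [Nonempty ι] [Fintype κ] [Nonempty κ]
    (A B : Matrix ι κ ℝ) : ∃ x y, IsBimatrixEquilibrium A B x y := by
  obtain ⟨z, h1, h2⟩ := exists_equilibrium_prod (ι := Unit) (κ := Unit)
    (fun _ i z => ∑ j, (z.2 ()).1 j * A i j)
    (fun _ i => continuous_finsetSum _ fun j _ => ((continuous_stdSimplex_coord j).comp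
      ((continuous_apply ()).comp continuous_snd)).mul continuous_const)
    (fun _ j z => ∑ i, (z.1 ()).1 i * B i j)
    (fun _ j => continuous_finsetSum _ fun i _ => ((continuous_stdSimplex_coord i).comp
      ((continuous_apply ()).comp continuous_fst)).mul continuous_const)
  refine ⟨z.1 (), z.2 (), fun x' => ?_, fun y' => ?_⟩
  · have e : ∀ x : stdSimplex ℝ ι, ∑ i, ∑ j, x.1 i * (z.2 ()).1 j * A i j =
        ∑ i, x.1 i * ∑ j, (z.2 ()).1 j * A i j := fun x => by
      simp_rw [Finset.mul_sum, mul_assoc]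
    rw [e, e]
    calc _ ≤ ∑ i, x'.1 i * _ :=
          Finset.sum_le_sum fun i _ => mul_le_mul_of_nonneg_left (h1 () i) (x'.2.1 i)
      _ = _ := by rw [← Finset.sum_mul, x'.2.2, one_mul]
  · have e : ∀ y : stdSimplex ℝ κ, ∑ i, ∑ j, (z.1 ()).1 i * y.1 j * B i j =
        ∑ j, y.1 j * ∑ i, (z.1 ()).1 i * B i j := fun y => by
      rw [Finset.sum_comm]
      simp_rw [Finset.mul_sum]
      exact Finset.sum_congr rfl fun j _ => Finset.sum_congr rfl fun i _ => by ring
    rw [e, e]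
    calc _ ≤ ∑ j, y'.1 j * _ :=
          Finset.sum_le_sum fun j _ => mul_le_mul_of_nonneg_left (h2 () j) (y'.2.1 j)
      _ = _ := by rw [← Finset.sum_mul, y'.2.2, one_mul]

end Nash

/-! ### Discounted sums of linearly growing terms. -/

section Discounting

open Filter Topology

theorem summable_discounted_linear {β : ℝ} (h0 : 0 < β) (h1 : β < 1) (K L n : ℝ) :
    Summable fun t : ℕ => β ^ t * (K + L * (n + t)) := by
  have hg : Summable fun t : ℕ => β ^ t := summable_geometric_of_lt_one h0.le h1
  have hl : Summable fun t : ℕ => (t : ℝ) * β ^ t := by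
    simpa using summable_pow_mul_geometric_of_norm_lt_one 1
      (show ‖β‖ < 1 by rwa [Real.norm_of_nonneg h0.le])
  exact ((hg.mul_left (K + L * n)).add (hl.mul_left L)).congr fun t => by ring

/-- A bound for discounted sums of stage utilities that grow at most linearly; it is affine in the
initial counter `n`. -/
theorem abs_tsum_discounted_le {β : ℝ} (h0 : 0 < β) (h1 : β < 1) {K L : ℝ} {n : ℕ} {f : ℕ → ℝ}
    (hf : ∀ t, |f t| ≤ K + L * (n + t)) :
    Summable (fun t => β ^ t * f t) ∧
      |∑' t, β ^ t * f t| ≤ (∑' t : ℕ, β ^ t * (K + L * (0 + t))) + L * (∑' t : ℕ, β ^ t) * n := by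
  have hs := summable_discounted_linear h0 h1 K L n
  have hle : ∀ t, ‖β ^ t * f t‖ ≤ β ^ t * (K + L * (n + t)) := fun t => by
    rw [norm_mul, norm_pow, Real.norm_of_nonneg h0.le]
    exact mul_le_mul_of_nonneg_left (hf t) (by positivity)
  refine ⟨.of_norm_bounded hs hle, (tsum_of_norm_bounded hs.hasSum hle).trans_eq ?_⟩
  rw [← tsum_mul_left, ← tsum_mul_right, ← (summable_discounted_linear h0 h1 K L 0).tsum_add
      (((summable_geometric_of_lt_one h0.le h1).mul_left _).mul_right _)]
  exact tsum_congr fun t => by ring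

end Discounting

/-! ### Averages over independent mixed actions. -/

section MixedAverage

variable {α γ : Type*} [Fintype α] [Fintype γ] (x : stdSimplex ℝ α) (y : stdSimplex ℝ γ)

theorem sum_mul_const_right (F : α → ℝ) :
    ∑ a, ∑ b, x.1 a * y.1 b * F a = ∑ a, x.1 a * F a := by
  refine Finset.sum_congr rfl fun a _ => ?_
  rw [← Finset.sum_mul, ← Finset.mul_sum, y.2.2, mul_one]

theorem sum_mul_const (c : ℝ) : ∑ a, ∑ b, x.1 a * y.1 b * c = c := by
  rw [sum_mul_const_right x y fun _ => c, ← Finset.sum_mul, x.2.2, one_mul]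

variable {x y} in
theorem sum_mul_mono {F F' : α → γ → ℝ} (h : ∀ a b, F a b ≤ F' a b) :
    ∑ a, ∑ b, x.1 a * y.1 b * F a b ≤ ∑ a, ∑ b, x.1 a * y.1 b * F' a b :=
  Finset.sum_le_sum fun a _ => Finset.sum_le_sum fun b _ =>
    mul_le_mul_of_nonneg_left (h a b) (mul_nonneg (x.2.1 a) (y.2.1 b))

variable {x y} in
theorem abs_sum_mul_le {F : α → γ → ℝ} {c : ℝ} (h : ∀ a b, |F a b| ≤ c) :
    |∑ a, ∑ b, x.1 a * y.1 b * F a b| ≤ c := by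
  rw [abs_le]
  constructor
  · rw [← sum_mul_const x y (-c)]
    exact sum_mul_mono fun a b => (abs_le.1 (h a b)).1
  · conv_rhs => rw [← sum_mul_const x y c]
    exact sum_mul_mono fun a b => (abs_le.1 (h a b)).2

theorem sum_mul_add (F F' : α → γ → ℝ) :
    ∑ a, ∑ b, x.1 a * y.1 b * (F a b + F' a b) =
      ∑ a, ∑ b, x.1 a * y.1 b * F a b + ∑ a, ∑ b, x.1 a * y.1 b * F' a b := by
  simp_rw [mul_add, Finset.sum_add_distrib]

theorem mul_sum_mul (c : ℝ) (F : α → γ → ℝ) :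
    ∑ a, ∑ b, x.1 a * y.1 b * (c * F a b) = c * ∑ a, ∑ b, x.1 a * y.1 b * F a b := by
  simp_rw [Finset.mul_sum]
  exact Finset.sum_congr rfl fun a _ => Finset.sum_congr rfl fun b _ => by ring

theorem sum_mul_eq_sum_left (F : α → γ → ℝ) :
    ∑ a, ∑ b, x.1 a * y.1 b * F a b = ∑ a, x.1 a * ∑ b, y.1 b * F a b := by
  simp_rw [Finset.mul_sum, mul_assoc]

theorem sum_mul_eq_sum_right (F : α → γ → ℝ) :
    ∑ a, ∑ b, x.1 a * y.1 b * F a b = ∑ b, y.1 b * ∑ a, x.1 a * F a b := by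
  rw [Finset.sum_comm]
  simp_rw [Finset.mul_sum]
  exact Finset.sum_congr rfl fun b _ => Finset.sum_congr rfl fun a _ => by ring

theorem sum_mul_le_of_le {F : α → ℝ} {c : ℝ} (h : ∀ a, F a ≤ c) : ∑ a, x.1 a * F a ≤ c :=
  calc ∑ a, x.1 a * F a ≤ ∑ a, x.1 a * c :=
        Finset.sum_le_sum fun a _ => mul_le_mul_of_nonneg_left (h a) (x.2.1 a)
    _ = c := by rw [← Finset.sum_mul, x.2.2, one_mul]

theorem hasSum_sum_mul {F : ℕ → α → γ → ℝ} {S : α → γ → ℝ}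
    (h : ∀ a b, HasSum (fun t => F t a b) (S a b)) :
    HasSum (fun t => ∑ a, ∑ b, x.1 a * y.1 b * F t a b) (∑ a, ∑ b, x.1 a * y.1 b * S a b) :=
  hasSum_sum fun a _ => hasSum_sum fun b _ => (h a b).mul_left _

end MixedAverage

/-! ### The stochastic game: values, deviations and equilibrium. -/

section Game

variable {N M : ℕ}

/-- The number of consecutive changes after the defender moves from `s` to `a`. -/
def nextCount (s : Method N M) (n : ℕ) (a : Method N M) : ℕ := if a = s then 0 else n + 1

theorem nextCount_le (s : Method N M) (n : ℕ) (a : Method N M) : nextCount s n a ≤ n + 1 := by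
  unfold nextCount
  split_ifs <;> omega

theorem History.changes_next (h : History N M) (a : Method N M) (b : Fin N) :
    (h.next a b).changes = nextCount h.state h.changes a := rfl

theorem changeCount_le (p : ℕ → Method N M) (t : ℕ) : changeCount p t ≤ t := by
  induction t with
  | zero => exact le_rfl
  | succ t ih =>
    unfold changeCount
    split_ifs <;> omega

/-- A step uses up one unit of remaining time and raises the counter by at most one, so the bound in
counter plus time propagates through inductions. -/
theorem linear_bound_succ {K L : ℝ} (hL : 0 ≤ L) {n n' t : ℕ} (h : n' ≤ n + 1) :
    K + L * (n' + t) ≤ K + L * (n + (t + 1 : ℕ)) := by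
  have : (n' : ℝ) ≤ n + 1 := by exact_mod_cast h
  push_cast
  have : L * (n' + t) ≤ L * (n + (t + 1)) := mul_le_mul_of_nonneg_left (by linarith) hL
  linarith

theorem abs_expectedStage_le (σ : DefStrategy N M) (τ : AttStrategy N M)
    {u : Method N M → Fin N → History N M → ℝ} {K L : ℝ} (hL : 0 ≤ L)
    (hu : ∀ a b h, |u a b h| ≤ K + L * h.changes) (t : ℕ) (h : History N M) :
    |expectedStage σ τ u t h| ≤ K + L * (h.changes + t) := by
  induction t generalizing h with
  | zero => simpa [expectedStage] using abs_sum_mul_le fun a b => hu a b h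
  | succ t ih =>
    refine abs_sum_mul_le fun a b => (ih _).trans (linear_bound_succ hL ?_)
    exact nextCount_le _ _ _

/-- The expected stage utility after `t` steps from state `s` and counter `n`, for strategies that
are stationary in the state and the counter. -/
def stationaryStage (E : Method N M → ℕ → stdSimplex ℝ (Method N M))
    (H : Method N M → ℕ → stdSimplex ℝ (Fin N)) (u : Method N M → Fin N → Method N M → ℕ → ℝ) :
    ℕ → Method N M → ℕ → ℝ
  | 0, s, n => ∑ a, ∑ b, (E s n).1 a * (H s n).1 b * u a b s n
  | t + 1, s, n => ∑ a, ∑ b, (E s n).1 a * (H s n).1 b *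
      stationaryStage E H u t a (nextCount s n a)

theorem expectedStage_stationary (E : Method N M → ℕ → stdSimplex ℝ (Method N M))
    (H : Method N M → ℕ → stdSimplex ℝ (Fin N)) (u : Method N M → Fin N → Method N M → ℕ → ℝ)
    (t : ℕ) (h : History N M) :
    expectedStage (stationary E) (stationary H) (fun a b h => u a b h.state h.changes) t h =
      stationaryStage E H u t h.state h.changes := by
  induction t generalizing h with
  | zero => rfl
  | succ t ih =>
    simp only [expectedStage, stationaryStage, ih]
    rfl

theorem abs_stationaryStage_le (E : Method N M → ℕ → stdSimplex ℝ (Method N M))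
    (H : Method N M → ℕ → stdSimplex ℝ (Fin N)) {u : Method N M → Fin N → Method N M → ℕ → ℝ}
    {K L : ℝ} (hL : 0 ≤ L) (hu : ∀ a b s n, |u a b s n| ≤ K + L * (n : ℕ)) (t : ℕ)
    (s : Method N M) (n : ℕ) : |stationaryStage E H u t s n| ≤ K + L * (n + t) := by
  induction t generalizing s n with
  | zero => simpa [stationaryStage] using abs_sum_mul_le fun a b => hu a b s n
  | succ t ih =>
    exact abs_sum_mul_le fun a b => (ih _ _).trans (linear_bound_succ hL (nextCount_le _ _ _))

theorem continuous_stationaryStage {Z : Type*} [TopologicalSpace Z]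
    {E : Z → Method N M → ℕ → stdSimplex ℝ (Method N M)}
    {H : Z → Method N M → ℕ → stdSimplex ℝ (Fin N)}
    (hE : ∀ s n, Continuous fun z => E z s n) (hH : ∀ s n, Continuous fun z => H z s n)
    (u : Method N M → Fin N → Method N M → ℕ → ℝ) (t : ℕ) (s : Method N M) (n : ℕ) :
    Continuous fun z => stationaryStage (E z) (H z) u t s n := by
  have hw : ∀ s n a b, Continuous fun z => (E z s n).1 a * (H z s n).1 b := fun s n a b =>
    ((continuous_stdSimplex_coord a).comp (hE s n)).mul
      ((continuous_stdSimplex_coord b).comp (hH s n))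
  induction t generalizing s n with
  | zero =>
    exact continuous_finsetSum _ fun a _ => continuous_finsetSum _ fun b _ =>
      (hw s n a b).mul continuous_const
  | succ t ih =>
    exact continuous_finsetSum _ fun a _ => continuous_finsetSum _ fun b _ =>
      (hw s n a b).mul (ih _ _)

namespace MTDGame

variable (G : MTDGame N M) {C : ℕ → ℝ} {L : ℝ}

theorem exists_abs_U₁_le (hC : ∀ n, |C n| ≤ L * n) :
    ∃ K : ℝ, ∀ a b s n, |G.U₁ C a b s n| ≤ K + L * n := by
  obtain ⟨K, hK⟩ := (Set.finite_range fun z : Method N M × Fin N × Method N M =>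
    |G.R₁ z.2.1 + G.T₁ z.1 z.2.1 z.2.2 - G.P₁ z.2.2|).bddAbove
  refine ⟨K, fun a b s n => (abs_sub _ _).trans (add_le_add ?_ (hC n))⟩
  exact hK ⟨(a, b, s), rfl⟩

theorem exists_abs_U₂_le : ∃ K : ℝ, ∀ a b s, |G.U₂ a b s| ≤ K := by
  obtain ⟨K, hK⟩ := (Set.finite_range fun z : Method N M × Fin N × Method N M =>
    |G.U₂ z.1 z.2.1 z.2.2|).bddAbove
  exact ⟨K, fun a b s => hK ⟨(a, b, s), rfl⟩⟩

/-- If the cost grows at most linearly, the accumulated utility of the defender converges and is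
bounded. -/
theorem exists_bound_Φ₁ (hL : 0 ≤ L) (hC : ∀ n, |C n| ≤ L * n) : ∃ B : ℝ,
    (∀ f g s, Summable (G.pureTerm₁ C f g s) ∧ |G.pureΦ₁ C f g s| ≤ B) ∧
    ∀ σ τ s, Summable (G.term₁ C σ τ s) ∧ |G.Φ₁ C σ τ s| ≤ B := by
  obtain ⟨K, hK⟩ := G.exists_abs_U₁_le hC
  have key : ∀ f : ℕ → ℝ, (∀ t, |f t| ≤ K + L * ((0 : ℕ) + t)) →
      Summable (fun t => G.β ^ t * f t) ∧ |∑' t, G.β ^ t * f t| ≤ _ :=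
    fun f hf => abs_tsum_discounted_le G.β_pos G.β_lt_one hf
  refine ⟨_, fun f g s => key _ fun t => (hK _ _ _ _).trans ?_, fun σ τ s => key _ fun t => ?_⟩
  · have : (changeCount (statePath f s) t : ℝ) ≤ t := by exact_mod_cast changeCount_le _ t
    have := mul_le_mul_of_nonneg_left this hL
    simpa using this
  · exact abs_expectedStage_le σ τ hL (fun a b h => hK a b h.state h.changes) t (.start s)

/-- The accumulated utility of the defender from state `s` and counter `n`. -/
noncomputable def value₁ (C : ℕ → ℝ) (E : Method N M → ℕ → stdSimplex ℝ (Method N M))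
    (H : Method N M → ℕ → stdSimplex ℝ (Fin N)) (s : Method N M) (n : ℕ) : ℝ :=
  ∑' t, G.β ^ t * stationaryStage E H (G.U₁ C) t s n

/-- The utility of the defender that plays `a` now and `E` afterwards, against `H`. -/
noncomputable def actionValue₁ (C : ℕ → ℝ) (E : Method N M → ℕ → stdSimplex ℝ (Method N M))
    (H : Method N M → ℕ → stdSimplex ℝ (Fin N)) (s : Method N M) (n : ℕ) (a : Method N M) : ℝ :=
  (∑ b, (H s n).1 b * G.U₁ C a b s n) + G.β * G.value₁ C E H a (nextCount s n a)

theorem sum_mul_actionValue₁ (E : Method N M → ℕ → stdSimplex ℝ (Method N M))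
    (H : Method N M → ℕ → stdSimplex ℝ (Fin N)) (s : Method N M) (n : ℕ)
    (x : stdSimplex ℝ (Method N M)) :
    ∑ a, x.1 a * G.actionValue₁ C E H s n a =
      ∑ a, ∑ b, x.1 a * (H s n).1 b *
        (G.U₁ C a b s n + G.β * G.value₁ C E H a (nextCount s n a)) := by
  rw [sum_mul_add, sum_mul_eq_sum_left, sum_mul_const_right x (H s n)
    fun a => G.β * G.value₁ C E H a (nextCount s n a), ← Finset.sum_add_distrib]
  simp only [actionValue₁, mul_add]

/-- The Bellman equation: the term at time zero is split off and the remaining series is regrouped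
by the first action pair. -/
theorem value₁_eq (hL : 0 ≤ L) (hC : ∀ n, |C n| ≤ L * n)
    (E : Method N M → ℕ → stdSimplex ℝ (Method N M))
    (H : Method N M → ℕ → stdSimplex ℝ (Fin N)) (s : Method N M) (n : ℕ) :
    G.value₁ C E H s n = ∑ a, (E s n).1 a * G.actionValue₁ C E H s n a := by
  obtain ⟨K, hK⟩ := G.exists_abs_U₁_le hC
  have hs : ∀ s n, Summable fun t => G.β ^ t * stationaryStage E H (G.U₁ C) t s n := fun s n =>
    (abs_tsum_discounted_le G.β_pos G.β_lt_one fun t => abs_stationaryStage_le E H hL hK t s n).1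
  rw [sum_mul_actionValue₁, sum_mul_add, value₁, (hs s n).tsum_eq_zero_add, pow_zero, one_mul]
  congr 1
  refine HasSum.tsum_eq ?_
  refine (hasSum_sum_mul (E s n) (H s n) fun a b =>
    (hs a (nextCount s n a)).hasSum.mul_left G.β).congr_fun fun t => ?_
  simp only [stationaryStage, ← mul_assoc, ← pow_succ', Finset.mul_sum]
  exact Finset.sum_congr rfl fun a _ => Finset.sum_congr rfl fun b _ => by ring

/-- Weierstrass's test: for fixed `s` and `n` the majorant of the terms is the same for all
strategies, so continuity in each coordinate suffices. -/
theorem continuous_value₁ (hL : 0 ≤ L) (hC : ∀ n, |C n| ≤ L * n) {Z : Type*} [TopologicalSpace Z]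
    {E : Z → Method N M → ℕ → stdSimplex ℝ (Method N M)}
    {H : Z → Method N M → ℕ → stdSimplex ℝ (Fin N)}
    (hE : ∀ s n, Continuous fun z => E z s n) (hH : ∀ s n, Continuous fun z => H z s n)
    (s : Method N M) (n : ℕ) : Continuous fun z => G.value₁ C (E z) (H z) s n := by
  obtain ⟨K, hK⟩ := G.exists_abs_U₁_le hC
  refine continuous_tsum (fun t => continuous_const.mul
    (continuous_stationaryStage hE hH (G.U₁ C) t s n))
    (summable_discounted_linear G.β_pos G.β_lt_one K L n) fun t z => ?_
  rw [norm_mul, norm_pow, Real.norm_of_nonneg G.β_pos.le]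
  exact mul_le_mul_of_nonneg_left (abs_stationaryStage_le _ _ hL hK t s n)
    (pow_nonneg G.β_pos.le t)

open Filter Topology in
/-- If no single action improves on `E` at any state and counter, no behaviour strategy does. -/
theorem Φ₁_le_of_actionValue₁_le (hL : 0 ≤ L) (hC : ∀ n, |C n| ≤ L * n)
    {E : Method N M → ℕ → stdSimplex ℝ (Method N M)} {H : Method N M → ℕ → stdSimplex ℝ (Fin N)}
    (hopt : ∀ s n a, G.actionValue₁ C E H s n a ≤ G.value₁ C E H s n) (σ : DefStrategy N M)
    (s : Method N M) :
    G.Φ₁ C σ (stationary H) s ≤ G.Φ₁ C (stationary E) (stationary H) s := by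
  obtain ⟨K, hK⟩ := G.exists_abs_U₁_le hC
  obtain ⟨K', L', hL', hV⟩ : ∃ K' L' : ℝ, 0 ≤ L' ∧
      ∀ s n, |G.value₁ C E H s n| ≤ K' + L' * n :=
    ⟨_, _, mul_nonneg hL (tsum_nonneg fun t => pow_nonneg G.β_pos.le t), fun s n =>
      (abs_tsum_discounted_le G.β_pos G.β_lt_one
        fun t => abs_stationaryStage_le E H hL hK t s n).2⟩
  let u : Method N M → Fin N → History N M → ℝ := fun a b h => G.U₁ C a b h.state h.changes
  -- Using any strategy for `T` steps gains at most the value plus an error bounding the discounted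
  -- continuation value. The error must involve the counter because costs are unbounded.
  have key : ∀ (T : ℕ) (h : History N M),
      ∑ t ∈ Finset.range T, G.β ^ t * expectedStage σ (stationary H) u t h ≤
        G.value₁ C E H h.state h.changes + G.β ^ T * (K' + L' * (h.changes + T)) := by
    intro T
    induction T with
    | zero =>
      intro h
      have := (abs_le.1 (hV h.state h.changes)).1
      simp only [Finset.range_zero, Finset.sum_empty, pow_zero, Nat.cast_zero, add_zero]
      linarith
    | succ T ih =>
      intro h
      have hstep : ∑ t ∈ Finset.range (T + 1), G.β ^ t * expectedStage σ (stationary H) u t h =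
          ∑ a, ∑ b, (σ h).1 a * (H h.state h.changes).1 b * (u a b h + G.β *
            ∑ t ∈ Finset.range T, G.β ^ t * expectedStage σ (stationary H) u t (h.next a b)) := by
        rw [Finset.sum_range_succ', sum_mul_add, add_comm]
        congr 1
        · simp [expectedStage, stationary]
        · rw [mul_sum_mul]
          simp_rw [pow_succ', mul_assoc G.β, ← Finset.mul_sum]
          congr 1
          rw [Finset.sum_congr rfl fun a _ => Finset.sum_congr rfl fun b _ => Finset.mul_sum ..,
            Finset.sum_congr rfl fun a _ => Finset.sum_comm, Finset.sum_comm]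
          refine Finset.sum_congr rfl fun t _ => ?_
          rw [expectedStage, ← mul_sum_mul]
          rfl
      rw [hstep]
      calc _ ≤ ∑ a, ∑ b, (σ h).1 a * (H h.state h.changes).1 b *
            ((G.U₁ C a b h.state h.changes +
              G.β * G.value₁ C E H a (nextCount h.state h.changes a)) +
              G.β ^ (T + 1) * (K' + L' * (h.changes + (T + 1 : ℕ)))) := by
            refine sum_mul_mono fun a b => ?_
            have h1 := mul_le_mul_of_nonneg_left (ih (h.next a b)) G.β_pos.le
            have h2 := mul_le_mul_of_nonneg_left (linear_bound_succ (K := K') (t := T) hL'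
              (nextCount_le h.state h.changes a)) (pow_nonneg G.β_pos.le (T + 1))
            rw [History.changes_next, mul_add, ← mul_assoc, ← pow_succ'] at h1
            have h3 : (h.next a b).state = a := rfl
            rw [h3] at h1
            simp only [u]
            linarith
        _ = ∑ a, (σ h).1 a * G.actionValue₁ C E H h.state h.changes a +
              G.β ^ (T + 1) * (K' + L' * (h.changes + (T + 1 : ℕ))) := by
            rw [sum_mul_add, sum_mul_const, ← sum_mul_actionValue₁]
        _ ≤ _ := by
            gcongr
            exact sum_mul_le_of_le _ (hopt _ _)
  have hsum : Summable (G.term₁ C σ (stationary H) s) :=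
    ((G.exists_bound_Φ₁ hL hC).choose_spec.2 σ (stationary H) s).1
  have hrhs : G.Φ₁ C (stationary E) (stationary H) s = G.value₁ C E H s 0 :=
    tsum_congr fun t => by rw [term₁, expectedStage_stationary]; rfl
  rw [hrhs]
  have hlim := (summable_discounted_linear G.β_pos G.β_lt_one K' L'
    ((0 : ℕ) : ℝ)).tendsto_atTop_zero.const_add (G.value₁ C E H s 0)
  rw [add_zero] at hlim
  exact le_of_tendsto_of_tendsto' hsum.hasSum.tendsto_sum_nat hlim fun T => key T (.start s)

/-- Since the attacker does not influence the transitions, a strategy that is optimal at every stage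
is optimal. -/
theorem Φ₂_le_of_stage_le {E : Method N M → ℕ → stdSimplex ℝ (Method N M)}
    {H : Method N M → ℕ → stdSimplex ℝ (Fin N)}
    (hopt : ∀ s n b, ∑ a, (E s n).1 a * G.U₂ a b s ≤
      ∑ c, (H s n).1 c * ∑ a, (E s n).1 a * G.U₂ a c s) (τ : AttStrategy N M) (s : Method N M) :
    G.Φ₂ (stationary E) τ s ≤ G.Φ₂ (stationary E) (stationary H) s := by
  obtain ⟨K, hK⟩ := G.exists_abs_U₂_le
  have hsum : ∀ τ, Summable (G.term₂ (stationary E) τ s) := fun τ =>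
    (abs_tsum_discounted_le G.β_pos G.β_lt_one fun t => abs_expectedStage_le (stationary E) τ le_rfl
      (u := fun a b h => G.U₂ a b h.state) (K := K) (fun a b h => by simpa using hK a b h.state) t
      (.start s)).1
  have key : ∀ (t : ℕ) (h : History N M),
      expectedStage (stationary E) τ (fun a b h => G.U₂ a b h.state) t h ≤
        expectedStage (stationary E) (stationary H) (fun a b h => G.U₂ a b h.state) t h := by
    intro t
    induction t with
    | zero =>
      intro h
      simp only [expectedStage]
      rw [sum_mul_eq_sum_right, sum_mul_eq_sum_right]
      exact sum_mul_le_of_le _ (hopt h.state h.changes)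
    | succ t ih =>
      intro h
      have e : ∀ h, expectedStage (stationary E) (stationary H) (fun a b h => G.U₂ a b h.state) t h
          = stationaryStage E H (fun a b s _ => G.U₂ a b s) t h.state h.changes :=
        expectedStage_stationary E H (fun a b s _ => G.U₂ a b s) t
      -- The next state and counter depend only on `a`, so the attacker's current mixed action `y`
      -- drops out of all later utilities.
      have e' : ∀ y : stdSimplex ℝ (Fin N), ∑ a, ∑ b, (stationary E h).1 a * y.1 b *
          expectedStage (stationary E) (stationary H) (fun a b h => G.U₂ a b h.state) t (h.next a b)
          = ∑ a, (stationary E h).1 a * stationaryStage E H (fun a b s _ => G.U₂ a b s) t a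
            (nextCount h.state h.changes a) := fun y => by
        rw [← sum_mul_const_right _ y]
        simp only [e]
        rfl
      simp only [expectedStage]
      refine (sum_mul_mono fun a b => ih (h.next a b)).trans_eq ?_
      rw [e', e']
  exact (hsum τ).tsum_le_tsum (fun t => mul_le_mul_of_nonneg_left (key t _)
    (pow_nonneg G.β_pos.le t)) (hsum _)

/-- If the cost grows at most linearly, the stochastic game has an equilibrium that is stationary in
the state and the counter. -/
theorem exists_isNashEquilibrium (hN : 0 < N) (hM : 0 < M) (hL : 0 ≤ L)
    (hC : ∀ n, |C n| ≤ L * n) :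
    ∃ (E : Method N M → ℕ → stdSimplex ℝ (Method N M))
      (H : Method N M → ℕ → stdSimplex ℝ (Fin N)),
      G.IsNashEquilibrium C (stationary E) (stationary H) := by
  have : Nonempty (Fin N) := ⟨⟨0, hN⟩⟩
  have : Nonempty (Fin M) := ⟨⟨0, hM⟩⟩
  let Z := (Method N M × ℕ → stdSimplex ℝ (Method N M)) × (Method N M × ℕ → stdSimplex ℝ (Fin N))
  let E : Z → Method N M → ℕ → stdSimplex ℝ (Method N M) := fun z s n => z.1 (s, n)
  let H : Z → Method N M → ℕ → stdSimplex ℝ (Fin N) := fun z s n => z.2 (s, n)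
  have hE : ∀ s n, Continuous fun z => E z s n := fun s n =>
    (continuous_apply (s, n)).comp continuous_fst
  have hH : ∀ s n, Continuous fun z => H z s n := fun s n =>
    (continuous_apply (s, n)).comp continuous_snd
  -- One agent of each player per state and counter. The attacker's agents are myopic; the
  -- defender's include the continuation value.
  obtain ⟨z, h1, h2⟩ := exists_equilibrium_prod
    (fun (i : Method N M × ℕ) a z => G.actionValue₁ C (E z) (H z) i.1 i.2 a)
    (fun i a => (continuous_finsetSum _ fun b _ => ((continuous_stdSimplex_coord b).comp
      (hH i.1 i.2)).mul continuous_const).add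
        (continuous_const.mul (G.continuous_value₁ hL hC hE hH _ _)))
    (fun (i : Method N M × ℕ) b z => ∑ a, (E z i.1 i.2).1 a * G.U₂ a b i.1)
    (fun i b => continuous_finsetSum _ fun a _ => ((continuous_stdSimplex_coord a).comp
      (hE i.1 i.2)).mul continuous_const)
  refine ⟨E z, H z, fun s => ⟨fun σ => ?_, fun τ => ?_⟩⟩
  · refine G.Φ₁_le_of_actionValue₁_le hL hC (fun s n a => ?_) σ s
    rw [G.value₁_eq hL hC]
    exact h1 (s, n) a
  · exact G.Φ₂_le_of_stage_le (fun s n b => h2 (s, n) b) τ s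

end MTDGame

/-- The only property of the logarithmic cost that the argument needs. -/
theorem abs_logCost_le (q : ℝ) (n : ℕ) : |logCost q n| ≤ |q| * n := by
  have h0 : 0 ≤ Real.log ((n : ℝ) + 1) := Real.log_nonneg (by simp)
  rw [logCost, abs_mul, abs_of_nonneg h0]
  refine mul_le_mul_of_nonneg_left ?_ (abs_nonneg q)
  have := Real.log_le_sub_one_of_pos (show (0 : ℝ) < n + 1 by positivity)
  linarith

end Game

theorem lemma2 {N M : ℕ} (hN : 0 < N) (hM : 0 < M) (G : MTDGame N M) (q : ℝ) :
    -- the accumulated utility of the defender converges and is bounded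
    (∃ B : ℝ,
      (∀ (f : Method N M → Method N M) (g : Method N M → Fin N) (s : Method N M),
        Summable (G.pureTerm₁ (logCost q) f g s) ∧ |G.pureΦ₁ (logCost q) f g s| ≤ B) ∧
      (∀ (σ : DefStrategy N M) (τ : AttStrategy N M) (s : Method N M),
        Summable (G.term₁ (logCost q) σ τ s) ∧ |G.Φ₁ (logCost q) σ τ s| ≤ B)) ∧
    -- the bimatrix game of the pure stationary strategies has a mixed equilibrium
    (∃ (x : stdSimplex ℝ (Method N M → Method N M)) (y : stdSimplex ℝ (Method N M → Fin N)),
      IsBimatrixEquilibrium (G.X (logCost q)) G.Y x y) ∧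
    -- the stochastic game has an equilibrium, stationary in the state and the number of changes
    (∃ (E : Method N M → ℕ → stdSimplex ℝ (Method N M)) (H : Method N M → ℕ → stdSimplex ℝ (Fin N)),
      G.IsNashEquilibrium (logCost q) (stationary E) (stationary H)) := by
  have : Nonempty (Fin N) := ⟨⟨0, hN⟩⟩
  have : Nonempty (Fin M) := ⟨⟨0, hM⟩⟩
  exact ⟨G.exists_bound_Φ₁ (abs_nonneg q) (abs_logCost_le q), exists_isBimatrixEquilibrium _ _,
    G.exists_isNashEquilibrium hN hM (abs_nonneg q) (abs_logCost_le q)⟩
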